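/- Let $f:\mathbb{R}^d\to\mathbb{R}\cup\{+\infty\}$ be proper, closed (lower semicontinuous) and convex with a minimizer $x^\star$, and let $\lambda>0$. Put $\mathrm{Prox}_{\lambda f}(x)=\arg\min_{y}\{f(y)+\frac{1}{2\lambda}\|y-x\|^2\}$. For a schedule $(\alpha_0,\dots,\alpha_{N-1})$ of positive numbers, the relaxed proximal point algorithm (RPPA) started at $x^0\in\mathbb{R}^d$ computes $z^k=\mathrm{Prox}_{\lambda f}(x^k)$ and $x^{k+1}=x^k+\alpha_k(z^k-x^k)$ for $0\le k\le N-1$, and outputs $z^N=\mathrm{Prox}_{\lambda f}(x^N)$. Let $\rho=1+\sqrt2$. The silver schedules $\pi^{(m)}\in\mathbb{R}^{2^m-1}$ are defined by letting $\pi^{(0)}$ be empty, $\pi^{(1)}=[\sqrt2]$ and $\pi^{(m+1)}=[\pi^{(m)},\,1+\rho^{m-1},\,\pi^{(m)}]$ for $m\ge1$. For $m\ge0$ let $\gamma_m=\frac12\bigl(1+\sqrt{1+4\rho^m}\bigr)$, let $\overline{\pi}^{(m)}=[\pi^{(m)},\gamma_m]\in\mathbb{R}^{2^m}$ be the right silver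 schedule, and let $T_m=1+\gamma_m+\sum_{i}\pi^{(m)}_i$. Theorem. For every $m\ge0$, $\gamma_m>0$, $\gamma_m^2=\gamma_m+\rho^m$ and $T_m=\gamma_m+\rho^m$. For every $m\ge 0$, with $N=2^m$, for all $d$, $f$, $\lambda$, $x^\star$ as above and every $x^0\in\mathbb{R}^d$, RPPA with schedule $\overline{\pi}^{(m)}$ can be run from $x^0$ (the proximal points exist), and the sequence it generates satisfies $$f(z^N)-f(x^\star)\le\frac{1}{2T_m}\,\frac{1}{2\lambda}\,\|x^0-x^\star\|^2 ,$$ where, as $m\to\infty$ with $N=2^m$, $T_m\sim N^{\log_2\rho}$, and hence the right-hand side is $\sim\frac{1}{2N^{\log_2\rho}}\frac{1}{2\lambda}\|x^0-x^\star\|^2$ for fixed $\lambda$ and $\|x^0-x^\star\|$. The bound is tight: for all $m\ge0$, $d\ge1$, $\lambda>0$ and all $x^0\ne x^\star$ in $\mathbb{R}^d$ there is a proper, closed, convex $f$ with minimizer $x^\star$ for which RPPA with schedule $\overline{\pi}^{(m)}$ started at $x^0$ attains equality. -/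

import Mathlib

/-- An extended-real-valued function is proper: never `-∞`, and not identically `+∞`. -/
def IsProperFun {d : ℕ} (f : EuclideanSpace ℝ (Fin d) → EReal) : Prop :=
  (∀ x, f x ≠ ⊥) ∧ ∃ x, f x ≠ ⊤

/-- Convexity of an extended-real-valued function: its epigraph is convex. -/
def IsConvexFun {d : ℕ} (f : EuclideanSpace ℝ (Fin d) → EReal) : Prop :=
  Convex ℝ {p : EuclideanSpace ℝ (Fin d) × ℝ | f p.1 ≤ (p.2 : EReal)}

/-- Proper, closed (lower semicontinuous) and convex. -/
structure IsProperClosedConvex {d : ℕ} (f : EuclideanSpace ℝ (Fin d) → EReal) : Prop where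
  proper : IsProperFun f
  closed : LowerSemicontinuous f
  convex : IsConvexFun f

/-- `z = Prox_{lam f}(x)`, that is, `z` minimizes `y ↦ f y + (1 / (2 lam)) ‖y - x‖ ^ 2`. -/
def IsProx {d : ℕ} (f : EuclideanSpace ℝ (Fin d) → EReal) (lam : ℝ)
    (x z : EuclideanSpace ℝ (Fin d)) : Prop :=
  IsMinOn (fun y => f y + ((1 / (2 * lam) * ‖y - x‖ ^ 2 : ℝ) : EReal)) Set.univ z

/-- `(x k, z k)`, `0 ≤ k ≤ N`, is generated by the relaxed proximal point algorithm for `f` with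
proximal parameter `lam` and relaxation schedule `α` of length `N`, from the starting point `x0`.
The values of `x` and `z` at indices larger than `N` are irrelevant. -/
structure IsRPPA {d : ℕ} (f : EuclideanSpace ℝ (Fin d) → EReal) (lam : ℝ) (α : List ℝ)
    (x0 : EuclideanSpace ℝ (Fin d)) (x z : ℕ → EuclideanSpace ℝ (Fin d)) : Prop where
  init : x 0 = x0
  prox : ∀ k, k ≤ α.length → IsProx f lam (x k) (z k)
  relax : ∀ (k : ℕ) (hk : k < α.length), x (k + 1) = x k + α[k] • (z k - x k)

/-- The silver ratio `ρ = 1 + √2`. -/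
noncomputable def silverRho : ℝ := 1 + √2

/-- The silver stepsize schedule `π^(m)`, of length `2 ^ m - 1` (empty for `m = 0`). -/
noncomputable def silver : ℕ → List ℝ
  | 0 => []
  | 1 => [√2]
  | m + 2 => silver (m + 1) ++ [1 + silverRho ^ m] ++ silver (m + 1)

/-- `γ_m`, the positive root of `γ ^ 2 = γ + ρ ^ m`. -/
noncomputable def silverGamma (m : ℕ) : ℝ := (1 + √(1 + 4 * silverRho ^ m)) / 2

/-- The right silver stepsize schedule `[π^(m), γ_m]`; for `m = 0` it is `[γ_0]`. -/
noncomputable def rightSilver (m : ℕ) : List ℝ := silver m ++ [silverGamma m]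

/-- `T_m = 1 + γ_m + ∑ π^(m)_i`. -/
noncomputable def silverT (m : ℕ) : ℝ := 1 + silverGamma m + (silver m).sum

theorem silver_length (m : ℕ) : (silver m).length + 1 = 2 ^ m := by
  induction m using Nat.strong_induction_on with
  | _ m ih =>
    match m with
    | 0 => simp [silver]
    | 1 => simp [silver]
    | m + 2 =>
      have h := ih (m + 1) (by omega)
      simp only [silver, List.length_append, List.length_singleton]
      rw [pow_succ 2 (m + 1)]
      omega

/-- The right silver schedule has `N = 2 ^ m` steps. -/
theorem rightSilver_length (m : ℕ) : (rightSilver m).length = 2 ^ m := by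
  simp [rightSilver, silver_length]

/-!
A proximal step `z = Prox_{λf}(x)` is characterised by the inequalities
`h z + ⟪x - z, p - z⟫ ≤ h p` for all `p` in the domain, where `h = λ f`. Call a schedule with
sum `S` primitive if every run from `x` to `y`, followed by the proximal step from `y` to `z`,
satisfies
`2 S (h z - h p) + ((S + 1)² - 1) ‖y - z‖² + ‖y - p‖² ≤ ‖x - p‖²`. The empty schedule is primitive,
and if two schedules with sums `r - 1` and `s - 1` are primitive, so is their concatenation
around the step `1 + c` with `c² + c (r + s) = r s`: adding the two estimates at `p` and the
proximal inequality at the junction leaves a term in `h z' - h z`, the decrease along the second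
half, which is controlled by applying the second estimate at the points `z` and `z'` themselves. For
`r = s` the equation reads `c = r / ρ`, which is the recursion of the silver schedules. A last step
`γ` with `γ² = γ + r` completes a square and gives the rate `4 (γ + r) (h z - h p) ≤ ‖x - p‖²`.

The bound is attained by a multiple of `‖y - x⋆‖`, with a slope so small that the
iterates move along the segment from `x⁰` towards `x⋆` by constant multiples of the stepsizes and
`z^N` is its midpoint.
-/

open Filter Asymptotics
open scoped RealInnerProductSpace Topology

section Runs

variable {E : Type*} [AddCommGroup E] [Module ℝ E] {P Q : E → E → Prop}

/-- `IsRelaxedRun P α x y`: the iteration `x ↦ x + a • (z - x)`, where `P x z`, leads from `x` to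
`y` as `a` runs through the schedule `α`. The relation `P` stands for `z = Prox x`. -/
inductive IsRelaxedRun (P : E → E → Prop) : List ℝ → E → E → Prop
  | nil (x : E) : IsRelaxedRun P [] x x
  | cons {a : ℝ} {α : List ℝ} {x y z : E} (step : P x z)
      (tail : IsRelaxedRun P α (x + a • (z - x)) y) : IsRelaxedRun P (a :: α) x y

namespace IsRelaxedRun

theorem mono (hPQ : ∀ x z, P x z → Q x z) {α : List ℝ} {x y : E} (h : IsRelaxedRun P α x y) :
    IsRelaxedRun Q α x y := by
  induction h with
  | nil x => exact nil x
  | cons step _ ih => exact cons (hPQ _ _ step) ih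

theorem exists_of_append {α β : List ℝ} {x y : E} (h : IsRelaxedRun P (α ++ β) x y) :
    ∃ w, IsRelaxedRun P α x w ∧ IsRelaxedRun P β w y := by
  induction α generalizing x with
  | nil => exact ⟨x, nil x, h⟩
  | cons a α ih =>
    obtain _ | ⟨step, tail⟩ := h
    obtain ⟨w, hα, hβ⟩ := ih tail
    exact ⟨w, cons step hα, hβ⟩

theorem exists_of_append_cons {α β : List ℝ} {a : ℝ} {x y : E}
    (h : IsRelaxedRun P (α ++ a :: β) x y) :
    ∃ w z, IsRelaxedRun P α x w ∧ P w z ∧ IsRelaxedRun P β (w + a • (z - w)) y := by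
  obtain ⟨w, hα, _ | ⟨step, tail⟩⟩ := h.exists_of_append
  exact ⟨w, _, hα, step, tail⟩

end IsRelaxedRun

end Runs

section Primitive

variable {E : Type*} [NormedAddCommGroup E] [InnerProductSpace ℝ E] {D : Set E} {h : E → ℝ}

/-- The variational characterisation of `z` as the proximal point of `x` for the function that is
`h` on `D` and `+∞` outside: `x - z` is a subgradient at `z`. -/
def IsProxStep (D : Set E) (h : E → ℝ) (x z : E) : Prop :=
  z ∈ D ∧ ∀ p ∈ D, h z + ⟪x - z, p - z⟫ ≤ h p

/-- The class of schedules, closed under concatenation with a suitable step in between, on which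
the convergence proof rests: a distance estimate holds along every relaxed run, whatever the
function. -/
def IsPrimitiveSchedule (E : Type*) [NormedAddCommGroup E] [InnerProductSpace ℝ E]
    (α : List ℝ) : Prop :=
  ∀ ⦃D : Set E⦄ ⦃h : E → ℝ⦄ ⦃x y z p : E⦄, IsRelaxedRun (IsProxStep D h) α x y →
    IsProxStep D h y z → p ∈ D →
    2 * α.sum * (h z - h p) + ((α.sum + 1) ^ 2 - 1) * ‖y - z‖ ^ 2 + ‖y - p‖ ^ 2 ≤ ‖x - p‖ ^ 2

theorem isProxStep_of_isMinOn (hh : ConvexOn ℝ D h) {x z : E} (hz : z ∈ D)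
    (hmin : IsMinOn (fun y => h y + ‖y - x‖ ^ 2 / 2) D z) : IsProxStep D h x z := by
  refine ⟨hz, fun p hp => ?_⟩
  have segment_bound : ∀ t ∈ Set.Ioo (0 : ℝ) 1,
      h z + ⟪x - z, p - z⟫ ≤ h p + t * (‖p - z‖ ^ 2 / 2) := by
    rintro t ⟨ht0, ht1⟩
    have hconv := hh.2 hz hp (sub_nonneg.2 ht1.le) ht0.le (sub_add_cancel 1 t)
    have hle : h z + ‖z - x‖ ^ 2 / 2 ≤
        h ((1 - t) • z + t • p) + ‖(1 - t) • z + t • p - x‖ ^ 2 / 2 :=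
      hmin (hh.1 hz hp (sub_nonneg.2 ht1.le) ht0.le (sub_add_cancel 1 t))
    have hnorm : ‖(1 - t) • z + t • p - x‖ ^ 2 =
        t ^ 2 * ‖p - z‖ ^ 2 - 2 * t * ⟪x - z, p - z⟫ + ‖z - x‖ ^ 2 := by
      rw [show (1 - t) • z + t • p - x = t • (p - z) - (x - z) by module, norm_sub_sq_real,
        norm_smul, real_inner_smul_left, mul_pow, Real.norm_eq_abs, sq_abs, norm_sub_rev z x,
        real_inner_comm]
      ring
    simp only [smul_eq_mul] at hconv
    refine le_of_mul_le_mul_left ?_ ht0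
    linarith
  have hlim : Tendsto (fun t : ℝ => h p + t * (‖p - z‖ ^ 2 / 2)) (𝓝[>] 0)
      (𝓝 (h p + 0 * (‖p - z‖ ^ 2 / 2))) :=
    (Continuous.tendsto (by fun_prop) 0).mono_left nhdsWithin_le_nhds
  simpa using ge_of_tendsto hlim (mem_of_superset (Ioo_mem_nhdsGT one_pos) segment_bound)

theorem norm_sub_sq_eq_add_inner (y z p : E) :
    ‖y - p‖ ^ 2 = ‖y - z‖ ^ 2 - 2 * ⟪y - z, p - z⟫ + ‖p - z‖ ^ 2 := by
  rw [← norm_sub_sq_real, sub_sub_sub_cancel_right]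

theorem norm_add_smul_sub_sub_sq (c : ℝ) (y z p : E) :
    ‖y + (1 + c) • (z - y) - p‖ ^ 2 =
      c ^ 2 * ‖y - z‖ ^ 2 + 2 * c * ⟪y - z, p - z⟫ + ‖p - z‖ ^ 2 := by
  rw [show y + (1 + c) • (z - y) - p = -(c • (y - z) + (p - z)) by module, norm_neg,
    norm_add_sq_real, norm_smul, real_inner_smul_left, mul_pow, Real.norm_eq_abs, sq_abs]
  ring

theorem isPrimitiveSchedule_nil : IsPrimitiveSchedule E [] := by
  rintro D h x _ z p ⟨⟩ - -
  simp

namespace IsPrimitiveSchedule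

variable {α β : List ℝ} {c : ℝ} {x y z y' z' p : E}

theorem concat_estimate (hα : IsPrimitiveSchedule E α) (hβ : IsPrimitiveSchedule E β)
    (hc : 0 ≤ c) (hxy : IsRelaxedRun (IsProxStep D h) α x y) (hyz : IsProxStep D h y z)
    (hy' : IsRelaxedRun (IsProxStep D h) β (y + (1 + c) • (z - y)) y')
    (hyz' : IsProxStep D h y' z') (hp : p ∈ D) :
    2 * (α.sum + 1 + c) * (h z - h p) + 2 * β.sum * (h z' - h p) +
      ((α.sum + 1) ^ 2 - c ^ 2) * ‖y - z‖ ^ 2 + ((β.sum + 1) ^ 2 - 1) * ‖y' - z'‖ ^ 2 +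
      ‖y' - p‖ ^ 2 ≤ ‖x - p‖ ^ 2 := by
  have first_half := hα hxy hyz hp
  have second_half := hβ hy' hyz' hp
  have prox_at_z := mul_le_mul_of_nonneg_left (hyz.2 p hp) (by linarith : 0 ≤ 1 + c)
  rw [norm_sub_sq_eq_add_inner y z p] at first_half
  rw [norm_add_smul_sub_sub_sq] at second_half
  linarith

theorem descent (hβ : IsPrimitiveSchedule E β) (hc : 0 ≤ c) (hyz : IsProxStep D h y z)
    (hy' : IsRelaxedRun (IsProxStep D h) β (y + (1 + c) • (z - y)) y')
    (hyz' : IsProxStep D h y' z') :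
    (β.sum + 1 - c) * (h z' - h z) + (β.sum + 1) ^ 2 * ‖y' - z'‖ ^ 2 ≤ c ^ 2 * ‖y - z‖ ^ 2 := by
  have estimate_at_z := hβ hy' hyz' hyz.1
  have estimate_at_z' := hβ hy' hyz' hyz'.1
  have prox_at_z := mul_le_mul_of_nonneg_left (hyz.2 z' hyz'.1) hc
  have prox_at_z' := hyz'.2 z hyz.1
  rw [norm_sub_sq_eq_add_inner y' z' z, norm_sub_rev z z'] at estimate_at_z
  simp only [norm_add_smul_sub_sub_sq, sub_self, inner_zero_right, norm_zero]
    at estimate_at_z estimate_at_z'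
  linarith

theorem concat (hα : IsPrimitiveSchedule E α) (hβ : IsPrimitiveSchedule E β)
    (hα0 : 0 < α.sum + 1) (hβ0 : 0 < β.sum + 1) (hc : 0 ≤ c)
    (hcαβ : c ^ 2 + c * ((α.sum + 1) + (β.sum + 1)) = (α.sum + 1) * (β.sum + 1)) :
    IsPrimitiveSchedule E (α ++ (1 + c) :: β) := by
  intro D h x y' z' p hrun hyz' hp
  obtain ⟨y, z, hxy, hyz, hy'⟩ := hrun.exists_of_append_cons
  have estimate := hα.concat_estimate hβ hc hxy hyz hy' hyz' hp
  have hcβ : 0 < β.sum + 1 - c := by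
    refine pos_of_mul_pos_right (a := α.sum + 1) ?_ hα0.le
    have : 0 < c := hc.lt_of_ne' fun h0 => (mul_pos hα0 hβ0).ne (by simpa [h0] using hcαβ)
    nlinarith
  have decrease : 2 * (h z' - h z) + (α.sum + 1 + c + 2 * (β.sum + 1)) * ‖y' - z'‖ ^ 2 ≤
      (α.sum + 1 - c) * ‖y - z‖ ^ 2 := by
    refine le_of_mul_le_mul_left ?_ hcβ
    linear_combination 2 * hβ.descent hc hyz hy' hyz' +
      (‖y - z‖ ^ 2 - ‖y' - z'‖ ^ 2) * hcαβ
  have : 0 ≤ α.sum + 1 + c := by linarith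
  rw [List.sum_append, List.sum_cons]
  linear_combination estimate + (α.sum + 1 + c) * decrease

theorem shifted_estimate (hα : IsPrimitiveSchedule E α) (hα0 : 0 ≤ α.sum + 1)
    (hxy : IsRelaxedRun (IsProxStep D h) α x y) (hyz : IsProxStep D h y z) (hp : p ∈ D) :
    4 * (α.sum + 1) * (h z - h p) + ‖z - (α.sum + 1) • (y - z) - p‖ ^ 2 ≤ ‖x - p‖ ^ 2 := by
  have estimate := hα hxy hyz hp
  have prox_at_z :=
    mul_le_mul_of_nonneg_left (hyz.2 p hp) (by linarith : 0 ≤ α.sum + 1 + 1)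
  rw [norm_sub_sq_eq_add_inner y z p] at estimate
  have hshift := norm_add_smul_sub_sub_sq (α.sum + 1) y z p
  rw [show y + (1 + (α.sum + 1)) • (z - y) = z - (α.sum + 1) • (y - z) by module] at hshift
  linarith

theorem rate_append_singleton (hα : IsPrimitiveSchedule E α) (hα0 : 0 ≤ α.sum + 1) {γ : ℝ}
    (hγ : 0 ≤ γ) (hγ2 : γ ^ 2 = γ + (α.sum + 1))
    (hrun : IsRelaxedRun (IsProxStep D h) (α ++ [γ]) x y') (hyz' : IsProxStep D h y' z')
    (hp : p ∈ D) : 4 * (γ + (α.sum + 1)) * (h z' - h p) ≤ ‖x - p‖ ^ 2 := by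
  obtain ⟨y, z, hxy, hyz, ⟨⟩⟩ := hrun.exists_of_append_cons
  have estimate := hα.shifted_estimate hα0 hxy hyz hp
  set r := α.sum + 1
  set v := y + γ • (z - y) - z' with hv
  set w := z - r • (y - z) - p with hw
  have prox_at_p := mul_le_mul_of_nonneg_left (hyz'.2 p hp) hγ
  have prox_at_z := mul_le_mul_of_nonneg_left (hyz'.2 z hyz.1) hα0
  have combination : γ • (p - z') + r • (z - z') = γ ^ 2 • v - γ • w := by
    rw [hv, hw]
    linear_combination (norm := module) hγ2 • (y - z - (y + γ • (z - y) - z'))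
  have square := sq_nonneg ‖w - (2 * γ) • v‖
  have inner_combination :
      γ * ⟪v, p - z'⟫ + r * ⟪v, z - z'⟫ = γ ^ 2 * ‖v‖ ^ 2 - γ * ⟪w, v⟫ := by
    rw [← real_inner_smul_right, ← real_inner_smul_right, ← inner_add_right, combination,
      inner_sub_right, real_inner_smul_right, real_inner_smul_right, real_inner_self_eq_norm_sq,
      real_inner_comm]
  rw [norm_sub_sq_real, real_inner_smul_right, norm_smul, mul_pow, Real.norm_eq_abs, sq_abs]
    at square
  linarith

end IsPrimitiveSchedule

end Primitive

section Silver

theorem silverRho_pos : 0 < silverRho := by unfold silverRho; positivity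

theorem one_lt_silverRho : 1 < silverRho := lt_add_of_pos_right 1 (Real.sqrt_pos.2 two_pos)

theorem silverRho_sq : silverRho ^ 2 = 2 * silverRho + 1 := by
  have hsqrt : √2 ^ 2 = (2 : ℝ) := Real.sq_sqrt zero_le_two
  unfold silverRho
  linear_combination hsqrt

theorem silverRho_inv : silverRho⁻¹ = √2 - 1 := by
  refine inv_eq_of_mul_eq_one_right ?_
  have hsqrt : √2 = silverRho - 1 := (add_sub_cancel_left _ _).symm
  rw [hsqrt]
  linear_combination silverRho_sq

theorem silver_succ (m : ℕ) :
    silver (m + 1) = silver m ++ (1 + silverRho ^ m / silverRho) :: silver m := by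
  cases m with
  | zero => simp [silver, silverRho_inv]
  | succ m => simp [silver, pow_succ, silverRho_pos.ne']

theorem silver_sum_add_one (m : ℕ) : (silver m).sum + 1 = silverRho ^ m := by
  induction m with
  | zero => simp [silver]
  | succ m ih =>
    rw [silver_succ, List.sum_append, List.sum_cons, eq_sub_of_add_eq ih]
    have hρ := silverRho_pos
    field_simp
    linear_combination -silverRho ^ m * silverRho_sq

theorem silver_nonneg (m : ℕ) : ∀ a ∈ silver m, 0 ≤ a := by
  induction m with
  | zero => simp [silver]
  | succ m ih =>
    have hmid : 0 ≤ 1 + silverRho ^ m / silverRho := by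
      have := silverRho_pos
      positivity
    simpa [silver_succ, or_imp, forall_and, hmid] using ih

theorem isPrimitiveSchedule_silver (E : Type*) [NormedAddCommGroup E] [InnerProductSpace ℝ E]
    (m : ℕ) : IsPrimitiveSchedule E (silver m) := by
  induction m with
  | zero => exact isPrimitiveSchedule_nil
  | succ m ih =>
    have hρ := silverRho_pos
    have hsum : 0 < (silver m).sum + 1 := by rw [silver_sum_add_one]; positivity
    rw [silver_succ]
    refine ih.concat ih hsum hsum (by positivity) ?_
    rw [silver_sum_add_one]
    field_simp
    linear_combination -silverRho_sq

theorem silverGamma_pos (m : ℕ) : 0 < silverGamma m := by unfold silverGamma; positivity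

theorem silverGamma_sq (m : ℕ) : silverGamma m ^ 2 = silverGamma m + silverRho ^ m := by
  have hsqrt : √(1 + 4 * silverRho ^ m) ^ 2 = 1 + 4 * silverRho ^ m :=
    Real.sq_sqrt (by have := silverRho_pos; positivity)
  unfold silverGamma
  linear_combination hsqrt / 4

theorem rightSilver_nonneg (m : ℕ) : ∀ a ∈ rightSilver m, 0 ≤ a := by
  simpa [rightSilver, or_imp, forall_and, (silverGamma_pos m).le] using silver_nonneg m

theorem rightSilver_sum_add_one (m : ℕ) : (rightSilver m).sum + 1 = silverT m := by
  rw [silverT, rightSilver, List.sum_append, List.sum_singleton]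
  ring

theorem silverT_eq (m : ℕ) : silverT m = silverGamma m + silverRho ^ m := by
  rw [silverT, ← silver_sum_add_one]
  ring

theorem silverT_pos (m : ℕ) : 0 < silverT m := by
  rw [silverT_eq]
  exact add_pos (silverGamma_pos m) (pow_pos silverRho_pos m)

theorem two_pow_rpow_logb_silverRho (m : ℕ) :
    ((2 ^ m : ℕ) : ℝ) ^ Real.logb 2 silverRho = silverRho ^ m := by
  rw [Nat.cast_pow, Nat.cast_ofNat, ← Real.rpow_pow_comm zero_le_two,
    Real.rpow_logb two_pos (by norm_num) silverRho_pos]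

theorem tendsto_silverGamma_atTop : Tendsto silverGamma atTop atTop := by
  have hpow := tendsto_pow_atTop_atTop_of_one_lt one_lt_silverRho
  have hradicand := tendsto_atTop_add_const_left atTop (1 : ℝ) (hpow.const_mul_atTop four_pos)
  exact (tendsto_atTop_add_const_left atTop 1
    (Real.tendsto_sqrt_atTop.comp hradicand)).atTop_div_const two_pos

theorem silverGamma_isLittleO : silverGamma =o[atTop] fun m => silverRho ^ m := by
  have hratio (m : ℕ) : silverGamma m / silverRho ^ m = (silverGamma m - 1)⁻¹ := by
    have hpow : silverRho ^ m = silverGamma m * (silverGamma m - 1) := by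
      linear_combination -silverGamma_sq m
    rw [hpow, div_mul_cancel_left₀ (silverGamma_pos m).ne']
  rw [isLittleO_iff_tendsto fun m h0 => absurd h0 (pow_pos silverRho_pos m).ne']
  simp only [hratio]
  exact tendsto_inv_atTop_zero.comp
    (tendsto_atTop_add_const_right atTop (-1) tendsto_silverGamma_atTop)

theorem silverT_isEquivalent :
    silverT ~[atTop] fun m => ((2 ^ m : ℕ) : ℝ) ^ Real.logb 2 silverRho := by
  simp only [two_pow_rpow_logb_silverRho, funext silverT_eq]
  exact silverGamma_isLittleO.add_isEquivalent .refl

theorem rightSilver_bound_isEquivalent (R lam : ℝ) :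
    (fun m => 1 / (2 * silverT m) * (1 / (2 * lam)) * R ^ 2) ~[atTop]
      fun m => 1 / (2 * ((2 ^ m : ℕ) : ℝ) ^ Real.logb 2 silverRho) * (1 / (2 * lam)) * R ^ 2 := by
  have hconst (c : ℝ) : (fun _ : ℕ => c) ~[atTop] fun _ => c := .refl
  exact (((hconst 1).div ((hconst 2).mul silverT_isEquivalent)).mul (hconst _)).mul (hconst _)

end Silver

section Prox

variable {d : ℕ} {f : EuclideanSpace ℝ (Fin d) → EReal} {lam : ℝ}

theorem IsConvexFun.convexOn_toReal (hconv : IsConvexFun f) (hbot : ∀ x, f x ≠ ⊥) :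
    ConvexOn ℝ {y | f y ≠ ⊤} fun y => (f y).toReal := by
  have combination_le : ∀ ⦃x⦄, f x ≠ ⊤ → ∀ ⦃y⦄, f y ≠ ⊤ → ∀ ⦃a b : ℝ⦄, 0 ≤ a → 0 ≤ b → a + b = 1 →
      f (a • x + b • y) ≤ ((a * (f x).toReal + b * (f y).toReal : ℝ) : EReal) :=
    fun x hx y hy a b ha hb hab =>
      hconv (x := (x, (f x).toReal)) (y := (y, (f y).toReal)) (EReal.le_coe_toReal hx)
        (EReal.le_coe_toReal hy) ha hb hab
  refine ⟨fun x hx y hy a b ha hb hab =>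
    ne_top_of_le_ne_top (EReal.coe_ne_top _) (combination_le hx hy ha hb hab),
    fun x hx y hy a b ha hb hab => ?_⟩
  exact (EReal.toReal_le_toReal (combination_le hx hy ha hb hab) (hbot _)
    (EReal.coe_ne_top _)).trans_eq (EReal.toReal_coe _)

theorem IsProx.ne_top {x z : EuclideanSpace ℝ (Fin d)} (hz : IsProx f lam x z)
    (hf : ∃ y, f y ≠ ⊤) : f z ≠ ⊤ := by
  obtain ⟨y, hy⟩ := hf
  intro htop
  have hle : f z + ((1 / (2 * lam) * ‖z - x‖ ^ 2 : ℝ) : EReal) ≤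
      f y + ((1 / (2 * lam) * ‖y - x‖ ^ 2 : ℝ) : EReal) := hz (Set.mem_univ y)
  rw [htop, EReal.top_add_coe, top_le_iff] at hle
  exact EReal.add_ne_top hy (EReal.coe_ne_top _) hle

theorem IsProx.isProxStep {x z : EuclideanSpace ℝ (Fin d)} (hz : IsProx f lam x z)
    (hf : IsProperFun f) (hconv : IsConvexFun f) (hlam : 0 < lam) :
    IsProxStep {y | f y ≠ ⊤} (fun y => lam * (f y).toReal) x z := by
  have hdom := hz.ne_top hf.2
  refine isProxStep_of_isMinOn ((hconv.convexOn_toReal hf.1).smul hlam.le) hdom fun y hy => ?_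
  have hle : f z + ((1 / (2 * lam) * ‖z - x‖ ^ 2 : ℝ) : EReal) ≤
      f y + ((1 / (2 * lam) * ‖y - x‖ ^ 2 : ℝ) : EReal) := hz (Set.mem_univ y)
  rw [← EReal.coe_toReal hdom (hf.1 z), ← EReal.coe_toReal hy (hf.1 y)] at hle
  norm_cast at hle
  have hscaled := mul_le_mul_of_nonneg_left hle hlam.le
  change lam * (f z).toReal + ‖z - x‖ ^ 2 / 2 ≤ lam * (f y).toReal + ‖y - x‖ ^ 2 / 2
  field_simp at hscaled ⊢
  exact hscaled

theorem exists_isProx (hf : LowerSemicontinuous f) {xstar : EuclideanSpace ℝ (Fin d)}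
    (hmin : IsMinOn f Set.univ xstar) (hlam : 0 < lam) (x : EuclideanSpace ℝ (Fin d)) :
    ∃ z, IsProx f lam x z := by
  have hlsc : LowerSemicontinuous
      (fun y => f y + ((1 / (2 * lam) * ‖y - x‖ ^ 2 : ℝ) : EReal)) :=
    hf.add' (continuous_coe_real_ereal.comp (by fun_prop)).lowerSemicontinuous fun y =>
      EReal.continuousAt_add (.inr (EReal.coe_ne_bot _)) (.inr (EReal.coe_ne_top _))
  have hxstar : xstar ∈ Metric.closedBall x ‖xstar - x‖ := by simp [dist_eq_norm]
  obtain ⟨z, -, hz⟩ := (hlsc.lowerSemicontinuousOn _).exists_isMinOn ⟨xstar, hxstar⟩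
    (isCompact_closedBall x ‖xstar - x‖)
  refine ⟨z, fun y _ => ?_⟩
  by_cases hy : y ∈ Metric.closedBall x ‖xstar - x‖
  · exact hz hy
  · rw [Metric.mem_closedBall, dist_eq_norm, not_le] at hy
    refine (hz hxstar).trans (add_le_add (hmin (Set.mem_univ y)) (EReal.coe_le_coe ?_))
    gcongr

theorem exists_isRPPA (hprox : ∀ x, ∃ z, IsProx f lam x z) (α : List ℝ)
    (x0 : EuclideanSpace ℝ (Fin d)) :
    ∃ x z : ℕ → EuclideanSpace ℝ (Fin d), IsRPPA f lam α x0 x z := by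
  choose prox hprox using hprox
  let x : ℕ → EuclideanSpace ℝ (Fin d) :=
    Nat.rec x0 fun k y => y + α.getD k 0 • (prox y - y)
  refine ⟨x, fun k => prox (x k), rfl, fun k _ => hprox _, fun k hk => ?_⟩
  rw [← List.getD_eq_getElem α 0 hk]

namespace IsRPPA

variable {α : List ℝ} {x0 : EuclideanSpace ℝ (Fin d)} {x z : ℕ → EuclideanSpace ℝ (Fin d)}

theorem tail {a : ℝ} (h : IsRPPA f lam (a :: α) x0 x z) :
    IsRPPA f lam α (x 1) (fun k => x (k + 1)) (fun k => z (k + 1)) where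
  init := rfl
  prox k hk := h.prox (k + 1) (Nat.succ_le_succ hk)
  relax k hk := h.relax (k + 1) (Nat.succ_lt_succ hk)

theorem isRelaxedRun (h : IsRPPA f lam α x0 x z) :
    IsRelaxedRun (IsProx f lam) α x0 (x α.length) := by
  induction α generalizing x0 x z with
  | nil => exact h.init ▸ .nil _
  | cons a α ih =>
    have hx1 : x 1 = x0 + a • (z 0 - x0) := h.init ▸ h.relax 0 (Nat.succ_pos _)
    exact .cons (h.init ▸ h.prox 0 (Nat.zero_le _)) (hx1 ▸ ih h.tail)

theorem rate {m : ℕ} {xstar : EuclideanSpace ℝ (Fin d)} (h : IsRPPA f lam (rightSilver m) x0 x z)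
    (hf : IsProperFun f) (hconv : IsConvexFun f) (hlam : 0 < lam)
    (hmin : IsMinOn f Set.univ xstar) :
    f (z (2 ^ m)) - f xstar ≤
      ((1 / (2 * silverT m) * (1 / (2 * lam)) * ‖x0 - xstar‖ ^ 2 : ℝ) : EReal) := by
  have hlast : IsProx f lam (x (2 ^ m)) (z (2 ^ m)) := h.prox _ (rightSilver_length m).ge
  have hz := hlast.ne_top hf.2
  have hxstar : f xstar ≠ ⊤ := ne_top_of_le_ne_top hz (hmin (Set.mem_univ _))
  have hrun := rightSilver_length m ▸ h.isRelaxedRun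
  have hstep (x z) (hxz : IsProx f lam x z) := hxz.isProxStep hf hconv hlam
  have hrate := (isPrimitiveSchedule_silver (EuclideanSpace ℝ (Fin d)) m).rate_append_singleton
    (by rw [silver_sum_add_one]; exact (pow_pos silverRho_pos m).le) (silverGamma_pos m).le
    (by rw [silver_sum_add_one]; exact silverGamma_sq m) (hrun.mono hstep)
    (hstep _ _ hlast) hxstar
  rw [silver_sum_add_one, ← silverT_eq] at hrate
  have hT := silverT_pos m
  rw [← EReal.coe_toReal hz (hf.1 _), ← EReal.coe_toReal hxstar (hf.1 _)]
  norm_cast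
  field_simp
  linarith

end IsRPPA

end Prox

section Tightness

variable {d : ℕ}

theorem isProperClosedConvex_mul_norm_sub {L : ℝ} (hL : 0 ≤ L) (p : EuclideanSpace ℝ (Fin d)) :
    IsProperClosedConvex fun y => ((L * ‖y - p‖ : ℝ) : EReal) where
  proper := ⟨fun x => EReal.coe_ne_bot _, p, EReal.coe_ne_top _⟩
  closed := (continuous_coe_real_ereal.comp (by fun_prop)).lowerSemicontinuous
  convex := by
    have hconv : ConvexOn ℝ Set.univ fun y : EuclideanSpace ℝ (Fin d) => L * ‖y - p‖ := by
      simpa [Function.comp_def, sub_eq_add_neg] using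
        (convexOn_univ_norm.translate_left (-p)).smul hL
    simpa only [IsConvexFun, EReal.coe_le_coe_iff, Set.mem_univ, true_and] using
      hconv.convex_epigraph

theorem isProx_mul_norm_sub {lam τ θ : ℝ} (hlam : 0 < lam) (hτ : 0 ≤ τ) (hθ : 0 ≤ θ)
    (p w : EuclideanSpace ℝ (Fin d)) :
    IsProx (fun y => ((τ / lam * ‖w‖ * ‖y - p‖ : ℝ) : EReal)) lam
      (p + (θ + τ) • w) (p + θ • w) := by
  intro y _
  have hz : ‖p + θ • w - (p + (θ + τ) • w)‖ ^ 2 = τ ^ 2 * ‖w‖ ^ 2 := by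
    rw [show p + θ • w - (p + (θ + τ) • w) = -(τ • w) by module, norm_neg, norm_smul, mul_pow,
      Real.norm_of_nonneg hτ]
  have hy : ‖y - (p + (θ + τ) • w)‖ ^ 2 =
      ‖y - p - θ • w‖ ^ 2 - 2 * τ * (⟪y - p, w⟫ - θ * ‖w‖ ^ 2) + τ ^ 2 * ‖w‖ ^ 2 := by
    rw [show y - (p + (θ + τ) • w) = (y - p - θ • w) - τ • w by module, norm_sub_sq_real,
      real_inner_smul_right, inner_sub_left, real_inner_smul_left, real_inner_self_eq_norm_sq,
      norm_smul, mul_pow, Real.norm_of_nonneg hτ]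
    ring
  have cauchy_schwarz := mul_le_mul_of_nonneg_left (real_inner_le_norm (y - p) w) hτ
  have hsq := sq_nonneg ‖y - p - θ • w‖
  simp only [Set.mem_ofPred_eq]
  norm_cast
  rw [hz, hy, add_sub_cancel_left, norm_smul, Real.norm_of_nonneg hθ]
  field_simp
  linarith

theorem isRPPA_mul_norm_sub {α : List ℝ} (hα : ∀ a ∈ α, 0 ≤ a) {lam τ : ℝ} (hlam : 0 < lam)
    (hτ : 0 ≤ τ) (hατ : (α.sum + 1) * τ ≤ 1) (p w : EuclideanSpace ℝ (Fin d)) :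
    IsRPPA (fun y => ((τ / lam * ‖w‖ * ‖y - p‖ : ℝ) : EReal)) lam α (p + w)
      (fun k => p + (1 - (α.take k).sum * τ) • w)
      (fun k => p + (1 - ((α.take k).sum + 1) * τ) • w) where
  init := by simp
  prox k _ := by
    have hsum : (α.take k).sum ≤ α.sum := (List.take_sublist k α).sum_le_sum hα
    have hθ : 0 ≤ 1 - ((α.take k).sum + 1) * τ :=
      sub_nonneg.2 ((mul_le_mul_of_nonneg_right (by linarith) hτ).trans hατ)
    have hx : 1 - (α.take k).sum * τ = 1 - ((α.take k).sum + 1) * τ + τ := by ring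
    rw [hx]
    exact isProx_mul_norm_sub hlam hτ hθ p w
  relax k hk := by
    rw [List.sum_take_succ α k hk]
    module

theorem exists_isRPPA_sub_eq {α : List ℝ} (hα : ∀ a ∈ α, 0 ≤ a) {lam : ℝ} (hlam : 0 < lam)
    (x0 xstar : EuclideanSpace ℝ (Fin d)) :
    ∃ f : EuclideanSpace ℝ (Fin d) → EReal,
      IsProperClosedConvex f ∧ IsMinOn f Set.univ xstar ∧
      ∃ x z : ℕ → EuclideanSpace ℝ (Fin d), IsRPPA f lam α x0 x z ∧
        f (z α.length) - f xstar =
          ((1 / (2 * (α.sum + 1)) * (1 / (2 * lam)) * ‖x0 - xstar‖ ^ 2 : ℝ) : EReal) := by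
  have hsum : 0 < α.sum + 1 := by linarith [List.sum_nonneg hα]
  set τ := 1 / (2 * (α.sum + 1)) with hτ
  have hhalf : (α.sum + 1) * τ = 1 / 2 := by rw [hτ]; field_simp
  have hslope : 0 ≤ τ / lam * ‖x0 - xstar‖ := by positivity
  have hvalue : τ / lam * ‖x0 - xstar‖ *
      ‖xstar + (1 - (α.sum + 1) * τ) • (x0 - xstar) - xstar‖ =
      τ * (1 / (2 * lam)) * ‖x0 - xstar‖ ^ 2 := by
    rw [hhalf, add_sub_cancel_left, norm_smul, Real.norm_of_nonneg (by norm_num)]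
    ring
  have hrun := isRPPA_mul_norm_sub hα hlam (by positivity) (hhalf.trans_le (by norm_num)) xstar
    (x0 - xstar)
  rw [add_sub_cancel] at hrun
  refine ⟨_, isProperClosedConvex_mul_norm_sub hslope xstar, fun y _ => ?_, _, _, hrun, ?_⟩
  · simp only [Set.mem_ofPred_eq, sub_self, norm_zero, mul_zero]
    exact EReal.coe_le_coe (by positivity)
  · rw [List.take_length, hvalue, sub_self, norm_zero, mul_zero, EReal.coe_zero, sub_zero]

end Tightness

theorem mainTheorem3 :
    -- the constants: `γ_m`, `T_m`, and `T_m ∼ N ^ (log₂ ρ)` for `N = 2 ^ m`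
    (∀ m : ℕ, 0 < silverGamma m ∧ silverGamma m ^ 2 = silverGamma m + silverRho ^ m ∧
      silverT m = silverGamma m + silverRho ^ m) ∧
    Asymptotics.IsEquivalent Filter.atTop silverT
      (fun m : ℕ => ((2 ^ m : ℕ) : ℝ) ^ Real.logb 2 silverRho) ∧
    (∀ R lam : ℝ, 0 < lam → Asymptotics.IsEquivalent Filter.atTop
      (fun m : ℕ => 1 / (2 * silverT m) * (1 / (2 * lam)) * R ^ 2)
      (fun m : ℕ => 1 / (2 * ((2 ^ m : ℕ) : ℝ) ^ Real.logb 2 silverRho) *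
        (1 / (2 * lam)) * R ^ 2)) ∧
    -- the algorithm can be run, and every run satisfies the upper bound
    (∀ (m d : ℕ) (f : EuclideanSpace ℝ (Fin d) → EReal) (lam : ℝ)
      (x0 xstar : EuclideanSpace ℝ (Fin d)),
      IsProperClosedConvex f → 0 < lam → IsMinOn f Set.univ xstar →
      (∃ x z : ℕ → EuclideanSpace ℝ (Fin d), IsRPPA f lam (rightSilver m) x0 x z) ∧
      ∀ x z : ℕ → EuclideanSpace ℝ (Fin d), IsRPPA f lam (rightSilver m) x0 x z →
        f (z (2 ^ m)) - f xstar ≤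
          ((1 / (2 * silverT m) * (1 / (2 * lam)) * ‖x0 - xstar‖ ^ 2 : ℝ) : EReal)) ∧
    -- tightness: the bound is attained
    (∀ (m d : ℕ) (lam : ℝ) (x0 xstar : EuclideanSpace ℝ (Fin d)), 0 < lam → x0 ≠ xstar →
      ∃ f : EuclideanSpace ℝ (Fin d) → EReal,
        IsProperClosedConvex f ∧ IsMinOn f Set.univ xstar ∧
        ∃ x z : ℕ → EuclideanSpace ℝ (Fin d), IsRPPA f lam (rightSilver m) x0 x z ∧
          f (z (2 ^ m)) - f xstar =
            ((1 / (2 * silverT m) * (1 / (2 * lam)) * ‖x0 - xstar‖ ^ 2 : ℝ) : EReal)) := by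
  refine ⟨fun m => ⟨silverGamma_pos m, silverGamma_sq m, silverT_eq m⟩, silverT_isEquivalent,
    fun R lam _ => rightSilver_bound_isEquivalent R lam, fun m d f lam x0 xstar hf hlam hmin =>
      ⟨exists_isRPPA (exists_isProx hf.closed hmin hlam) _ x0,
        fun x z h => h.rate hf.proper hf.convex hlam hmin⟩,
    fun m d lam x0 xstar hlam _ => ?_⟩
  simpa only [rightSilver_length, rightSilver_sum_add_one] using
    exists_isRPPA_sub_eq (rightSilver_nonneg m) hlam x0 xstar
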